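/- Consider the online $b$-matching problem with variable server capacities. An input is a finite bipartite graph $G=(S\cup R,E)$. The servers $s\in S$ and their capacities $b_s\in\mathbb{N}$, $b_s\ge 1$, are known in advance. The requests $r\in R$ arrive one by one; when $r$ arrives, its incident edges are revealed and an online algorithm must immediately and irrevocably match $r$ to an adjacent server or leave it unmatched, where each server $s$ may be matched with at most $b_s$ requests. $G$ is a $(k,d)$-graph if every server $s$ has degree at least $k\cdot b_s$ and every request has degree at most $d$. Let $\mathrm{ALG}(G)$ be the number of requests matched by a deterministic online algorithm $\mathrm{ALG}$, and let $\mathrm{OPT}(G)$ be the maximum size of a $b$-matching of $G$. The algorithm is $c$-competitive on a class of inputs if $\mathrm{ALG}(G)\ge c\cdot \mathrm{OPT}(G)$ for all $G$ in the class. Let $k\ge d\ge 2$ be integers, let $B$ be a nonempty finite set of positive integers, and let $b_{\min}=\min B$. If a deterministic online algorithm is $c$-competitive, for some real number $c$, on the class of all $(k,d)$-graphs whose set of server capacities is $\{b_s : s\in S\}=B$ (so that $\min_{s\in S} b_s=b_{\min}$), then \[ c\le c^*_{\min} := 1-\frac{1}{b_{\min}}\left(\sum_{i=1}^{b_{\min}}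 i\binom{k b_{\min}}{b_{\min}-i}\frac{1}{(d-1)^{b_{\min}-i}}\right)\left(1-\frac1d\right)^{k b_{\min}} . \] That is, no deterministic online algorithm for the $b$-matching problem with variable server capacities achieves a competitive ratio better than $c^*_{\min}$ on $(k,d)$-graphs with $k\ge d$. -/

import Mathlib

namespace OnlineBMatching

/-- An input of the online `b`-matching problem: a finite bipartite graph between the servers
`Fin numServers`, which are known in advance together with their capacities, and a sequence of
requests.  A request is given by the set of its adjacent servers, and the requests are listed in
the order of their arrival. -/
structure Instance where
  numServers : ℕ
  cap : Fin numServers → ℕ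
  requests : List (Finset (Fin numServers))

namespace Instance

/-- The degree of the server `s`. -/
def serverDegree (I : Instance) (s : Fin I.numServers) : ℕ :=
  (Finset.univ.filter fun r : Fin I.requests.length => s ∈ I.requests.get r).card

/-- `(k, d)`-graphs: every server `s` has degree at least `k * b_s`, every request has degree at
most `d`. -/
def IsKDGraph (I : Instance) (k d : ℕ) : Prop :=
  (∀ s, k * I.cap s ≤ I.serverDegree s) ∧
    ∀ r : Fin I.requests.length, (I.requests.get r).card ≤ d

/-- The set `{b_s : s a server}` of server capacities. -/
def capacities (I : Instance) : Finset ℕ := Finset.univ.image I.cap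

/-- An assignment of requests to servers (`none`: the request stays unmatched). -/
abbrev Assignment (I : Instance) : Type :=
  Fin I.requests.length → Option (Fin I.numServers)

/-- An assignment is a `b`-matching if requests are matched only along edges, and every server `s`
is matched with at most `b_s` requests. -/
def IsBMatching (I : Instance) (M : I.Assignment) : Prop :=
  (∀ r s, M r = some s → s ∈ I.requests.get r) ∧
    ∀ s, (Finset.univ.filter fun r => M r = some s).card ≤ I.cap s

/-- The number of matched requests. -/
def size (I : Instance) (M : I.Assignment) : ℕ :=
  (Finset.univ.filter fun r => (M r).isSome).card

open Classical in
/-- The maximum size of a `b`-matching. -/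
noncomputable def opt (I : Instance) : ℕ :=
  (Finset.univ.filter fun M : I.Assignment => I.IsBMatching M).sup I.size

end Instance

/-- A deterministic online algorithm.  When a request arrives, the algorithm knows the servers and
their capacities and the list `revealed` of the requests that have arrived so far, the current one
being the last, and decides irrevocably to which server, if any, the current request is matched.
Its own earlier decisions are determined by these data.  On every input, the decisions have to form
a `b`-matching. -/
structure OnlineAlgorithm where
  assign : {n : ℕ} → (cap : Fin n → ℕ) → (revealed : List (Finset (Fin n))) → Option (Fin n)
  isBMatching : ∀ I : Instance,
    I.IsBMatching fun r => assign I.cap (I.requests.take (r.val + 1))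

namespace OnlineAlgorithm

/-- The assignment constructed by the algorithm on the input `I`. -/
def run (A : OnlineAlgorithm) (I : Instance) : I.Assignment :=
  fun r => A.assign I.cap (I.requests.take (r.val + 1))

/-- The number of requests matched by the algorithm on the input `I`. -/
def value (A : OnlineAlgorithm) (I : Instance) : ℕ := I.size (A.run I)

/-- `A` is `c`-competitive on a class `C` of inputs. -/
def IsCompetitiveOn (A : OnlineAlgorithm) (c : ℝ) (C : Set Instance) : Prop :=
  ∀ I ∈ C, c * (I.opt : ℝ) ≤ (A.value I : ℝ)

end OnlineAlgorithm

/-- The ratio `c^*` for the capacity `b`. -/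
noncomputable def cStar (k d b : ℕ) : ℝ :=
  1 - 1 / (b : ℝ) *
    (∑ i ∈ Finset.Icc 1 b,
      (i : ℝ) * (Nat.choose (k * b) (b - i) : ℝ) * (1 / ((d : ℝ) - 1) ^ (b - i))) *
    (1 - 1 / (d : ℝ)) ^ (k * b)

end OnlineBMatching

/-! An adversary makes every server of capacity `b = b_min` look as if each of its first `K = k * b`
requests were matched to it independently with probability `1 / d`. A request is joined to `d`
servers that agree in degree and load; at most one of them gains, so the average gain is at most `1
/ d`. With `expectedLoad` as the potential of a server, i.e. its expected final load under that
random process, no decision of the algorithm increases the total (`potential_concat_le`). For a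
server of degree `K` the potential is its load, and initially it is `E[min b X]` with `X` binomial
with parameters `K`, `1 / d`, which equals `b * cStar` (`expectedLoad_eq_mul_cStar`).

By pigeonhole such `d` servers exist until all but a constant number of servers have degree `K`. The
stragglers, and one server for each capacity in `B`, cost only an additive constant. Since `d ≤ k`,
Hall's theorem gives an optimum that fills every server (`IsKDGraph.sum_cap_le_opt`). With many
servers of capacity `b` the additive constant becomes negligible. -/

namespace OnlineBMatching

/-! ### The optimum of a `(k, d)`-graph -/

namespace Instance

/-- Double counting of the edges between a set of servers and the requests adjacent to it. -/
theorem sum_serverDegree_le (I : Instance) {d : ℕ}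
    (hd : ∀ r : Fin I.requests.length, (I.requests.get r).card ≤ d)
    (T : Finset (Fin I.numServers)) :
    ∑ s ∈ T, I.serverDegree s ≤
      d * (T.biUnion fun s => Finset.univ.filter fun r : Fin I.requests.length =>
        s ∈ I.requests.get r).card := by
  classical
  set N := T.biUnion fun s => Finset.univ.filter fun r : Fin I.requests.length =>
        s ∈ I.requests.get r with hN
  have h1 : ∀ s ∈ T, I.serverDegree s = (N.filter fun r => s ∈ I.requests.get r).card := by
    intro s hs
    unfold serverDegree
    congr 1
    ext r
    simp only [Finset.mem_filter, Finset.mem_univ, true_and, hN, Finset.mem_biUnion]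
    exact ⟨fun h => ⟨⟨s, hs, h⟩, h⟩, fun h => h.2⟩
  rw [Finset.sum_congr rfl h1]
  refine (Finset.sum_card_bipartiteAbove_eq_sum_card_bipartiteBelow
    (fun (s : Fin I.numServers) (r : Fin I.requests.length) => s ∈ I.requests.get r)).trans_le ?_
  rw [mul_comm, ← smul_eq_mul]
  refine Finset.sum_le_card_nsmul _ _ _ fun r _ => (Finset.card_le_card ?_).trans (hd r)
  intro s hs
  exact (Finset.mem_filter.mp hs).2

/-- In a `(k, d)`-graph with `k ≥ d` some `b`-matching exhausts the capacities of all servers. -/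
theorem IsKDGraph.sum_cap_le_opt {I : Instance} {k d : ℕ} (hI : I.IsKDGraph k d) (hd : 0 < d)
    (hkd : d ≤ k) : ∑ s, I.cap s ≤ I.opt := by
  classical
  let nbr : (Σ s : Fin I.numServers, Fin (I.cap s)) → Finset (Fin I.requests.length) :=
    fun x => Finset.univ.filter fun r => x.1 ∈ I.requests.get r
  -- Hall's condition for `b_s` copies of each server `s`: with `T` the servers occurring in `X` and
  -- `N` their neighbourhood, `d * |X| ≤ k * ∑ cap ≤ ∑ deg ≤ d * |N|`, sums over `T`.
  have hall : ∀ X : Finset (Σ s : Fin I.numServers, Fin (I.cap s)),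
      X.card ≤ (X.biUnion nbr).card := by
    intro X
    have h1 : X.card ≤ ∑ s ∈ X.image Sigma.fst, I.cap s := by
      have : X ⊆ (X.image Sigma.fst).sigma fun s => (Finset.univ : Finset (Fin (I.cap s))) := by
        intro x hx
        simp only [Finset.mem_sigma, Finset.mem_univ, and_true]
        exact Finset.mem_image_of_mem _ hx
      simpa using Finset.card_le_card this
    have h2 := I.sum_serverDegree_le hI.2 (X.image Sigma.fst)
    rw [Finset.image_biUnion] at h2
    have h3 : ∑ s ∈ X.image Sigma.fst, k * I.cap s ≤
        ∑ s ∈ X.image Sigma.fst, I.serverDegree s := Finset.sum_le_sum fun s _ => hI.1 s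
    rw [← Finset.mul_sum] at h3
    refine Nat.le_of_mul_le_mul_left ?_ hd
    exact (Nat.mul_le_mul hkd h1).trans (h3.trans h2)
  obtain ⟨f, hf, hmem⟩ := (Finset.all_card_le_biUnion_card_iff_exists_injective nbr).mp hall
  let M : I.Assignment := fun r =>
    if h : ∃ x, f x = r then some h.choose.1 else none
  have hM : ∀ r s, M r = some s → ∃ i, f ⟨s, i⟩ = r := by
    intro r s h
    by_cases hx : ∃ x, f x = r
    · simp only [M, dif_pos hx, Option.some.injEq] at h
      subst h
      exact ⟨hx.choose.2, hx.choose_spec⟩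
    · rw [show M r = none from dif_neg hx] at h
      cases h
  have hB : I.IsBMatching M := by
    refine ⟨fun r s h => ?_, fun s => ?_⟩
    · obtain ⟨i, rfl⟩ := hM r s h
      exact (Finset.mem_filter.mp (hmem ⟨s, i⟩)).2
    · calc _ ≤ (Finset.univ.image fun i : Fin (I.cap s) => f ⟨s, i⟩).card := by
            refine Finset.card_le_card fun r hr => ?_
            obtain ⟨i, hi⟩ := hM r s (Finset.mem_filter.mp hr).2
            exact Finset.mem_image.mpr ⟨i, Finset.mem_univ _, hi⟩
        _ ≤ I.cap s := Finset.card_image_le.trans (by simp)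
  calc ∑ s, I.cap s = (Finset.univ.image f).card := by
        rw [Finset.card_image_of_injective _ hf]; simp
    _ ≤ I.size M := by
        refine Finset.card_le_card fun r hr => ?_
        obtain ⟨x, _, hx⟩ := Finset.mem_image.mp hr
        have h : ∃ x, f x = r := ⟨x, hx⟩
        rw [Finset.mem_filter, show M r = some h.choose.1 from dif_pos h]
        exact ⟨Finset.mem_univ _, rfl⟩
    _ ≤ I.opt := by
        unfold opt
        exact Finset.le_sup (f := I.size) (Finset.mem_filter.mpr ⟨Finset.mem_univ _, hB⟩)

end Instance

/-! ### The potential of a server -/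

/-- The expected value of `min b (j + X)`, where `X` is binomial with parameters `m` and `1 / d`. -/
noncomputable def expectedLoad (b d : ℕ) : ℕ → ℕ → ℝ
  | 0, j => min (b : ℝ) j
  | m + 1, j => (1 - 1 / (d : ℝ)) * expectedLoad b d m j + 1 / (d : ℝ) * expectedLoad b d m (j + 1)

theorem one_sub_one_div_natCast_nonneg (d : ℕ) : 0 ≤ 1 - 1 / (d : ℝ) := by
  rcases Nat.eq_zero_or_pos d with rfl | hd
  · simp
  · have : (1 : ℝ) ≤ d := by exact_mod_cast hd
    rw [sub_nonneg]
    exact (div_le_one (by linarith)).mpr this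

theorem expectedLoad_nonneg (b d m j : ℕ) : 0 ≤ expectedLoad b d m j := by
  induction m generalizing j with
  | zero => simp only [expectedLoad]; positivity
  | succ m ih =>
    exact add_nonneg (mul_nonneg (one_sub_one_div_natCast_nonneg d) (ih j))
      (mul_nonneg (by positivity) (ih _))

/-- Ensures that the adversary loses nothing when the algorithm leaves a request unmatched. -/
theorem expectedLoad_mono (b d m : ℕ) : Monotone (expectedLoad b d m) := by
  induction m with
  | zero =>
    intro i j h
    exact min_le_min le_rfl (by exact_mod_cast h)
  | succ m ih =>
    intro i j h
    exact add_le_add (mul_le_mul_of_nonneg_left (ih h) (one_sub_one_div_natCast_nonneg d))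
      (mul_le_mul_of_nonneg_left (ih (by omega)) (by positivity))

theorem expectedLoad_eq_sum (b d m j : ℕ) :
    expectedLoad b d m j = ∑ ij ∈ Finset.HasAntidiagonal.antidiagonal m, (m.choose ij.1 : ℝ) *
      ((1 / (d : ℝ)) ^ ij.1 * (1 - 1 / (d : ℝ)) ^ ij.2 * min (b : ℝ) ((j : ℝ) + ij.1)) := by
  induction m generalizing j with
  | zero => simp [expectedLoad]
  | succ m ih =>
    rw [Finset.sum_antidiagonal_choose_succ_mul (fun i l => (1 / (d : ℝ)) ^ i *
      (1 - 1 / (d : ℝ)) ^ l * min (b : ℝ) ((j : ℝ) + i))]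
    rw [expectedLoad, ih, ih, Finset.mul_sum, Finset.mul_sum]
    congr 1
    · refine Finset.sum_congr rfl fun ij _ => ?_
      ring
    · refine Finset.sum_congr rfl fun ij hij => ?_
      rw [Finset.HasAntidiagonal.mem_antidiagonal] at hij
      -- Pascal's rule leaves the coefficient of this half indexed by `ij.2`.
      rw [← Nat.choose_symm_of_eq_add hij.symm]
      push_cast
      rw [add_assoc, add_comm (1 : ℝ)]
      ring

/-- Write `E[min b X] = b - E[(b - X)⁺]`; substituting `i = b - X` turns the second term into the
sum in `cStar`. -/
theorem expectedLoad_eq_mul_cStar {k d b : ℕ} (hd : 2 ≤ d) (hk : 1 ≤ k) (hb : 1 ≤ b) :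
    expectedLoad b d (k * b) 0 = b * cStar k d b := by
  have hd' : (2 : ℝ) ≤ d := by exact_mod_cast hd
  have hb' : (b : ℝ) ≠ 0 := by positivity
  have hbK : b ≤ k * b := Nat.le_mul_of_pos_left b hk
  set K := k * b with hK
  set p : ℝ := 1 / (d : ℝ) with hp
  have hone : ∑ ij ∈ Finset.HasAntidiagonal.antidiagonal K, (K.choose ij.1 : ℝ) * (p ^ ij.1 * (1 - p) ^ ij.2)
      = 1 := by
    have h := (Commute.all p (1 - p)).add_pow' K
    rw [add_sub_cancel, one_pow] at h
    simpa only [nsmul_eq_mul] using h.symm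
  have hsub : expectedLoad b d K 0 = b - ∑ ij ∈ Finset.HasAntidiagonal.antidiagonal K,
      (K.choose ij.1 : ℝ) * (p ^ ij.1 * (1 - p) ^ ij.2) * ((b - ij.1 : ℕ) : ℝ) := by
    rw [expectedLoad_eq_sum, eq_sub_iff_add_eq, ← Finset.sum_add_distrib]
    refine Eq.trans ?_ ((Finset.mul_sum _ _ _).symm.trans
      ((congrArg ((b : ℝ) * ·) hone).trans (mul_one (b : ℝ))))
    refine Finset.sum_congr rfl fun ij _ => ?_
    -- The subtraction is truncated, so it is the positive part.
    have : min (b : ℝ) ij.1 + ((b - ij.1 : ℕ) : ℝ) = b := by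
      rw [← Nat.cast_min, ← Nat.cast_add]
      congr 1
      omega
    rw [Nat.cast_zero, zero_add, ← hp]
    linear_combination ((K.choose ij.1 : ℝ) * (p ^ ij.1 * (1 - p) ^ ij.2)) * this
  have hterm : ∀ j ≤ K, p ^ j * (1 - p) ^ (K - j) = 1 / ((d : ℝ) - 1) ^ j * (1 - p) ^ K := by
    intro j hj
    have h1 : (1 - p) ^ K = (1 - p) ^ (K - j) * (1 - p) ^ j := by
      rw [← pow_add, Nat.sub_add_cancel hj]
    have h2 : p * ((d : ℝ) - 1) = 1 - p := by rw [hp]; field_simp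
    have h3 : ((d : ℝ) - 1) ^ j ≠ 0 := pow_ne_zero _ (by linarith)
    rw [h1, ← h2, mul_pow p _ j]
    field_simp
  have hsum : ∑ ij ∈ Finset.HasAntidiagonal.antidiagonal K,
      (K.choose ij.1 : ℝ) * (p ^ ij.1 * (1 - p) ^ ij.2) * ((b - ij.1 : ℕ) : ℝ) =
      (∑ i ∈ Finset.Icc 1 b, (i : ℝ) * (K.choose (b - i) : ℝ) * (1 / ((d : ℝ) - 1) ^ (b - i))) *
        (1 - p) ^ K := by
    rw [Finset.Nat.sum_antidiagonal_eq_sum_range_succ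
      (fun i l => (K.choose i : ℝ) * (p ^ i * (1 - p) ^ l) * ((b - i : ℕ) : ℝ)), Finset.sum_mul]
    symm
    refine Finset.sum_of_injOn (fun i => b - i) ?_ ?_ ?_ ?_
    · intro i hi j hj h
      simp only [Finset.coe_Icc, Set.mem_Icc] at hi hj h
      omega
    · intro i hi
      simp only [Finset.coe_Icc, Set.mem_Icc, Finset.coe_range, Set.mem_Iio] at hi ⊢
      omega
    · intro i _ hi
      have : b - i = 0 := by
        by_contra h
        exact hi ⟨b - i, by simp only [Finset.coe_Icc, Set.mem_Icc]; omega, by simp only; omega⟩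
      simp [this]
    · intro i hi
      rw [Finset.mem_Icc] at hi
      rw [hterm _ (by omega), show b - (b - i) = i by omega]
      ring
  rw [hsub, hsum, cStar, ← hK, ← hp]
  field_simp

/-! ### Degrees and loads along a request sequence -/

/-- The degree of the server `s` in the request sequence `L`. -/
def degree {n : ℕ} (L : List (Finset (Fin n))) (s : Fin n) : ℕ := L.countP (s ∈ ·)

theorem Instance.serverDegree_eq_degree (I : Instance) (s : Fin I.numServers) :
    I.serverDegree s = degree I.requests s := by
  unfold serverDegree degree
  rw [Finset.card_filter]
  refine (Fin.sum_univ_fun_getElem I.requests fun X => if s ∈ X then 1 else 0).trans ?_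
  induction I.requests with
  | nil => rfl
  | cons X L ih => simp [List.countP_cons, ih, add_comm]

theorem degree_concat {n : ℕ} (L : List (Finset (Fin n))) (X : Finset (Fin n)) (s : Fin n) :
    degree (L ++ [X]) s = degree L s + if s ∈ X then 1 else 0 := by
  simp [degree, List.countP_append, List.countP_cons]

namespace OnlineAlgorithm

variable (A : OnlineAlgorithm) {n : ℕ} (cap : Fin n → ℕ)

/-- The number of requests in the sequence `L` that `A` matches to the server `s`. -/
def load (L : List (Finset (Fin n))) (s : Fin n) : ℕ :=
  ((Finset.range L.length).filter fun i => A.assign cap (L.take (i + 1)) = some s).card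

theorem card_filter_run_eq_load (I : Instance) (s : Fin I.numServers) :
    (Finset.univ.filter fun r => A.run I r = some s).card = A.load I.cap I.requests s := by
  unfold load run
  rw [Finset.card_filter, Finset.card_filter]
  exact Fin.sum_univ_eq_sum_range
    (fun i => if A.assign I.cap (I.requests.take (i + 1)) = some s then 1 else 0) _

/-- Any request sequence, in particular one still under construction, is itself an input on which
`A` must be feasible. -/
theorem load_le_cap (L : List (Finset (Fin n))) (s : Fin n) : A.load cap L s ≤ cap s := by
  have h := (A.isBMatching ⟨n, cap, L⟩).2 s
  rwa [← A.card_filter_run_eq_load ⟨n, cap, L⟩ s]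

theorem value_eq_sum_load (I : Instance) :
    A.value I = ∑ s, A.load I.cap I.requests s := by
  simp only [← A.card_filter_run_eq_load, Finset.card_filter]
  rw [Finset.sum_comm, value, Instance.size, Finset.card_filter]
  refine Finset.sum_congr rfl fun r _ => ?_
  cases A.run I r <;> simp

theorem mem_of_assign_concat {L : List (Finset (Fin n))} {X : Finset (Fin n)} {s : Fin n}
    (h : A.assign cap (L ++ [X]) = some s) : s ∈ X := by
  have hlt : L.length < (L ++ [X]).length := by simp
  have := (A.isBMatching ⟨n, cap, L ++ [X]⟩).1 ⟨L.length, hlt⟩ s (by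
    simpa [List.take_of_length_le] using h)
  simpa using this

/-- This is where being online matters: decisions on `L` see only prefixes of `L`, so a later
request cannot change them. -/
theorem load_concat (L : List (Finset (Fin n))) (X : Finset (Fin n)) (s : Fin n) :
    A.load cap (L ++ [X]) s =
      A.load cap L s + if A.assign cap (L ++ [X]) = some s then 1 else 0 := by
  unfold load
  rw [Finset.card_filter, Finset.card_filter, List.length_append, List.length_singleton,
    Finset.sum_range_succ, List.take_of_length_le (by simp)]
  congr 1
  refine Finset.sum_congr rfl fun i hi => ?_
  rw [List.take_append_of_le_length (by have := Finset.mem_range.mp hi; omega)]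

theorem load_concat_of_notMem (L : List (Finset (Fin n))) {X : Finset (Fin n)} {s : Fin n}
    (h : s ∉ X) : A.load cap (L ++ [X]) s = A.load cap L s := by
  rw [load_concat, if_neg fun h' => h (A.mem_of_assign_concat cap h'), add_zero]

theorem load_append_of_notMem (L F : List (Finset (Fin n))) {s : Fin n}
    (h : ∀ X ∈ F, s ∉ X) : A.load cap (L ++ F) s = A.load cap L s := by
  induction F using List.reverseRecOn with
  | nil => simp
  | append_singleton F X ih =>
    rw [← List.append_assoc, A.load_concat_of_notMem cap _ (h X (by simp)),
      ih fun Y hY => h Y (by simp [hY])]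

/-! ### The adversary -/

/-- The total potential of the servers in `S`, where the adversary aims at the degree `K`. -/
noncomputable def potential (b d K : ℕ) (S : Finset (Fin n)) (L : List (Finset (Fin n))) : ℝ :=
  ∑ s ∈ S, expectedLoad b d (K - degree L s) (A.load cap L s)

/-- A request whose `d` neighbours have equal degrees and equal loads does not increase the
potential, whatever the algorithm does. -/
theorem potential_concat_le {b d K t j : ℕ} (hd : 0 < d) {S X : Finset (Fin n)}
    {L : List (Finset (Fin n))} (hXS : X ⊆ S) (hX : X.card = d) (ht : t < K)
    (hdeg : ∀ s ∈ X, degree L s = t) (hload : ∀ s ∈ X, A.load cap L s = j) :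
    A.potential cap b d K S (L ++ [X]) ≤ A.potential cap b d K S L := by
  unfold potential
  rw [← Finset.sum_sdiff hXS, ← Finset.sum_sdiff hXS (f := fun s =>
    expectedLoad b d (K - degree L s) (A.load cap L s))]
  refine add_le_add (Finset.sum_le_sum fun s hs => ?_) ?_
  · have hs' := (Finset.mem_sdiff.mp hs).2
    rw [A.load_concat_of_notMem cap L hs', degree_concat, if_neg hs', add_zero]
  obtain ⟨m, rfl⟩ : ∃ m, K = t + 1 + m := Nat.exists_eq_add_of_le ht
  set δ : ℝ := expectedLoad b d m (j + 1) - expectedLoad b d m j with hδ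
  have hδ0 : 0 ≤ δ := sub_nonneg.mpr (expectedLoad_mono b d m (Nat.le_succ j))
  have h1 : ∀ s ∈ X, expectedLoad b d (t + 1 + m - degree (L ++ [X]) s)
      (A.load cap (L ++ [X]) s) =
      expectedLoad b d m j + if A.assign cap (L ++ [X]) = some s then δ else 0 := by
    intro s hs
    rw [degree_concat, if_pos hs, hdeg s hs, load_concat, hload s hs, Nat.add_sub_cancel_left]
    split_ifs <;> simp [hδ]
  have h2 : ∀ s ∈ X, expectedLoad b d (t + 1 + m - degree L s) (A.load cap L s) =
      expectedLoad b d (m + 1) j := by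
    intro s hs
    rw [hdeg s hs, hload s hs, show t + 1 + m - t = m + 1 by omega]
  have h3 : ∑ s ∈ X, (if A.assign cap (L ++ [X]) = some s then δ else 0) ≤ δ := by
    cases A.assign cap (L ++ [X]) with
    | none => simpa using hδ0
    | some a =>
      simp only [Option.some.injEq, Finset.sum_ite_eq]
      split_ifs
      exacts [le_rfl, hδ0]
  rw [Finset.sum_congr rfl h1, Finset.sum_congr rfl h2, Finset.sum_add_distrib,
    Finset.sum_const, Finset.sum_const, hX, nsmul_eq_mul, nsmul_eq_mul]
  have hd' : (d : ℝ) ≠ 0 := by positivity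
  -- The recursion of `expectedLoad` is exactly the case where one of the `d` neighbours gains a
  -- unit of load.
  have h4 : (d : ℝ) * expectedLoad b d (m + 1) j = d * expectedLoad b d m j + δ := by
    rw [expectedLoad, hδ]
    field_simp
    ring
  rw [h4]
  exact add_le_add le_rfl h3

/-- The request sequences that the adversary builds up. -/
structure IsAdversarial (b d K : ℕ) (S : Finset (Fin n)) (L : List (Finset (Fin n))) : Prop where
  card_le : ∀ X ∈ L, X.card ≤ d
  degree_le : ∀ s ∈ S, degree L s ≤ K
  length_le : L.length ≤ ∑ s ∈ S, degree L s
  potential_le : A.potential cap b d K S L ≤ S.card * expectedLoad b d K 0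

theorem isAdversarial_nil (b d K : ℕ) (S : Finset (Fin n)) :
    A.IsAdversarial cap b d K S [] where
  card_le := by simp
  degree_le := by simp [degree]
  length_le := by simp
  potential_le := by simp [potential, degree, load]

/-- As long as many servers have not reached the degree `K`, the adversary can go on. -/
theorem IsAdversarial.exists_concat {b d K : ℕ} (hd : 0 < d) {S : Finset (Fin n)}
    (hS : ∀ s ∈ S, cap s = b) {L : List (Finset (Fin n))} (hL : A.IsAdversarial cap b d K S L)
    (hcard : K * (b + 1) * d < (S.filter fun s => degree L s < K).card) :
    ∃ X, A.IsAdversarial cap b d K S (L ++ [X]) := by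
  have hmaps : ∀ s ∈ S.filter (fun s => degree L s < K),
      (degree L s, A.load cap L s) ∈ Finset.range K ×ˢ Finset.range (b + 1) := by
    intro s hs
    rw [Finset.mem_filter] at hs
    have := A.load_le_cap cap L s
    rw [hS s hs.1] at this
    simp only [Finset.mem_product, Finset.mem_range]
    omega
  -- There are `K * (b + 1)` classes, given by a degree below `K` and a load at most `b`; one
  -- contains more than `d` servers.
  obtain ⟨⟨t, j⟩, htj, hlt⟩ := Finset.exists_lt_card_fiber_of_mul_lt_card_of_maps_to hmaps
    (n := d) (by simpa using hcard)
  obtain ⟨X, hXsub, hX⟩ := Finset.exists_subset_card_eq hlt.le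
  have hXprop : ∀ s ∈ X, s ∈ S ∧ degree L s = t ∧ A.load cap L s = j := by
    intro s hs
    have := hXsub hs
    simp only [Finset.mem_filter, Prod.mk.injEq] at this
    exact ⟨this.1.1, this.2⟩
  have ht : t < K := by
    simp only [Finset.mem_product, Finset.mem_range] at htj
    exact htj.1
  have hXS : X ⊆ S := fun s hs => (hXprop s hs).1
  refine ⟨X, ?_, ?_, ?_, ?_⟩
  · intro Y hY
    rcases List.mem_append.mp hY with h | h
    · exact hL.card_le Y h
    · rw [List.mem_singleton.mp h, hX]
  · intro s hs
    rw [degree_concat]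
    split_ifs with h
    · rw [(hXprop s h).2.1]; exact ht
    · exact hL.degree_le s hs
  · simp only [degree_concat, Finset.sum_add_distrib, List.length_append, List.length_singleton]
    refine add_le_add hL.length_le ?_
    rw [← Finset.card_filter, Finset.filter_mem_eq_inter, Finset.inter_eq_right.mpr hXS, hX]
    exact hd
  · exact (A.potential_concat_le cap hd hXS hX ht (fun s hs => (hXprop s hs).2.1)
      fun s hs => (hXprop s hs).2.2).trans hL.potential_le

/-- The process stops: each request adds at least one edge at `S`, and `S` receives at most `S.card
* K` edges in total. -/
theorem exists_isAdversarial {b d : ℕ} (K : ℕ) (hd : 0 < d) {S : Finset (Fin n)}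
    (hS : ∀ s ∈ S, cap s = b) :
    ∃ L, A.IsAdversarial cap b d K S L ∧
      (S.filter fun s => degree L s < K).card ≤ K * (b + 1) * d := by
  by_contra! hcon
  have hlong : ∀ m, ∃ L, A.IsAdversarial cap b d K S L ∧ L.length = m := by
    intro m
    induction m with
    | zero => exact ⟨[], A.isAdversarial_nil cap b d K S, rfl⟩
    | succ m ih =>
      obtain ⟨L, hL, hm⟩ := ih
      obtain ⟨X, hX⟩ := hL.exists_concat A cap hd hS (hcon L hL)
      exact ⟨_, hX, by simp [hm]⟩
  obtain ⟨L, hL, hlen⟩ := hlong (S.card * K + 1)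
  have h1 := Finset.sum_le_card_nsmul S (degree L) K hL.degree_le
  have h2 := hL.length_le
  rw [smul_eq_mul] at h1
  have h3 := h2.trans h1
  omega

end OnlineAlgorithm

/-! ### Completing the input -/

/-- Requests of degree one that raise the degrees of all servers to the required minimum. -/
noncomputable def filler {n : ℕ} (k : ℕ) (cap : Fin n → ℕ) (L : List (Finset (Fin n))) :
    List (Finset (Fin n)) :=
  ((Finset.univ.filter fun s => degree L s < k * cap s).toList).flatMap
    -- More than the missing degree, which is harmless as server degrees are only bounded below.
    fun s => List.replicate (k * cap s) {s}

theorem mem_filler {n k : ℕ} {cap : Fin n → ℕ} {L : List (Finset (Fin n))} {X : Finset (Fin n)}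
    (h : X ∈ filler k cap L) : ∃ s, degree L s < k * cap s ∧ X = {s} := by
  simp only [filler, List.mem_flatMap, Finset.mem_toList, Finset.mem_filter, Finset.mem_univ,
    true_and] at h
  obtain ⟨s, hs, hX⟩ := h
  exact ⟨s, hs, List.eq_of_mem_replicate hX⟩

theorem le_degree_append_filler {n : ℕ} (k : ℕ) (cap : Fin n → ℕ) (L : List (Finset (Fin n)))
    (s : Fin n) : k * cap s ≤ degree (L ++ filler k cap L) s := by
  unfold degree
  rw [List.countP_append]
  by_cases hs : degree L s < k * cap s
  · refine le_add_left ?_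
    have hmem : List.replicate (k * cap s) ({s} : Finset (Fin n)) ∈
        ((Finset.univ.filter fun s => degree L s < k * cap s).toList).map
          fun s => List.replicate (k * cap s) ({s} : Finset (Fin n)) :=
      List.mem_map.mpr ⟨s, by simpa using hs, rfl⟩
    have h := (List.sublist_flatten_of_mem hmem).countP_le (p := fun X => decide (s ∈ X))
    rw [filler, List.flatMap_def]
    simpa [List.countP_replicate] using h
  · exact le_add_right (not_lt.mp hs)

/-- Against every algorithm there is a `(k, d)`-graph with prescribed capacities on which the loads
of the servers of capacity `b` are essentially at most the expected ones. -/
theorem OnlineAlgorithm.exists_isKDGraph_value_le (A : OnlineAlgorithm) {n : ℕ} (cap : Fin n → ℕ)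
    {k d : ℕ} (b : ℕ) (hd : 0 < d) :
    ∃ L, Instance.IsKDGraph ⟨n, cap, L⟩ k d ∧
      (A.value ⟨n, cap, L⟩ : ℝ) ≤
        (Finset.univ.filter fun s => cap s = b).card * expectedLoad b d (k * b) 0 +
          ((b * (k * b * (b + 1) * d) +
            ∑ s ∈ Finset.univ.filter (fun s => ¬ cap s = b), cap s : ℕ) : ℝ) := by
  set S := Finset.univ.filter fun s => cap s = b with hS
  have hcap : ∀ s ∈ S, cap s = b := fun s hs => (Finset.mem_filter.mp hs).2
  obtain ⟨L, hL, hleft⟩ := A.exists_isAdversarial cap (k * b) hd hcap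
  refine ⟨L ++ filler k cap L, ⟨fun s => ?_, fun r => ?_⟩, ?_⟩
  · rw [Instance.serverDegree_eq_degree]
    exact le_degree_append_filler k cap L s
  · rcases List.mem_append.mp (List.get_mem (L ++ filler k cap L) r) with h | h
    · exact hL.card_le _ h
    · obtain ⟨s, _, hs⟩ := mem_filler h
      change ((L ++ filler k cap L).get r).card ≤ d
      rw [hs, Finset.card_singleton]
      exact hd
  · rw [A.value_eq_sum_load, ← Finset.sum_filter_add_sum_filter_not Finset.univ
      (fun s => cap s = b), ← hS]
    simp only
    push_cast
    rw [← add_assoc]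
    refine add_le_add ?_ (Finset.sum_le_sum fun s _ => by exact_mod_cast A.load_le_cap cap _ s)
    -- A server that has reached degree `k * b` gets no filler, and its potential is its load. The
    -- few others are charged their full capacity `b`.
    have hpt : ∀ s ∈ S, (A.load cap (L ++ filler k cap L) s : ℝ) ≤
        expectedLoad b d (k * b - degree L s) (A.load cap L s) +
          if degree L s < k * b then (b : ℝ) else 0 := by
      intro s hs
      have hle := A.load_le_cap cap (L ++ filler k cap L) s
      rw [hcap s hs] at hle
      split_ifs with h
      · exact le_add_of_nonneg_of_le (expectedLoad_nonneg _ _ _ _) (by exact_mod_cast hle)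
      · have heq := A.load_append_of_notMem cap L (filler k cap L) (s := s) fun X hX hsX => by
          obtain ⟨s', hs', rfl⟩ := mem_filler hX
          rw [← Finset.mem_singleton.mp hsX, hcap s hs] at hs'
          exact h hs'
        rw [heq] at hle ⊢
        rw [Nat.sub_eq_zero_of_le (not_lt.mp h), expectedLoad, add_zero]
        exact le_min (by exact_mod_cast hle) le_rfl
    refine (Finset.sum_le_sum hpt).trans ?_
    rw [Finset.sum_add_distrib, ← Finset.sum_filter, Finset.sum_const, nsmul_eq_mul]
    refine add_le_add hL.potential_le ?_
    rw [mul_comm]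
    exact mul_le_mul_of_nonneg_left (by exact_mod_cast hleft) (Nat.cast_nonneg b)

/-! ### The capacities -/

/-- `N` servers of capacity `b`, followed by one server for each capacity in `B`. -/
def capacityProfile (B : Finset ℕ) (b N : ℕ) : Fin (N + B.card) → ℕ :=
  Fin.append (fun _ : Fin N => b) (B.orderEmbOfFin rfl)

theorem image_capacityProfile {B : Finset ℕ} {b : ℕ} (hb : b ∈ B) (N : ℕ) :
    Finset.univ.image (capacityProfile B b N) = B := by
  ext x
  simp only [Finset.mem_image, Finset.mem_univ, true_and]
  constructor
  · rintro ⟨i, rfl⟩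
    refine Fin.addCases (fun i => ?_) (fun i => ?_) i
    · simpa [capacityProfile] using hb
    · simp [capacityProfile]
  · intro hx
    have : x ∈ Set.range (B.orderEmbOfFin rfl) := by simpa using hx
    obtain ⟨i, hi⟩ := this
    exact ⟨Fin.natAdd N i, by simpa [capacityProfile] using hi⟩

theorem le_card_capacityProfile_eq (B : Finset ℕ) (b N : ℕ) :
    N ≤ (Finset.univ.filter fun s => capacityProfile B b N s = b).card := by
  have h := Finset.card_le_card_of_injOn (s := (Finset.univ : Finset (Fin N)))
    (t := Finset.univ.filter fun s => capacityProfile B b N s = b) (Fin.castAdd B.card)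
    (fun i _ => Finset.mem_filter.mpr ⟨Finset.mem_univ _, by simp [capacityProfile]⟩)
    ((Fin.castAdd_injective N B.card).injOn)
  simpa using h

/-- The bound does not depend on `N`, so these servers contribute only a constant. -/
theorem sum_capacityProfile_ne_le (B : Finset ℕ) (b N : ℕ) :
    ∑ s ∈ Finset.univ.filter (fun s => ¬ capacityProfile B b N s = b), capacityProfile B b N s ≤
      ∑ i, B.orderEmbOfFin rfl i := by
  rw [Finset.sum_filter, Fin.sum_univ_add]
  simp only [capacityProfile, Fin.append_left, Fin.append_right, not_true_eq_false, if_false,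
    Finset.sum_const_zero, zero_add]
  refine Finset.sum_le_sum fun i _ => ?_
  split_ifs
  · exact Nat.zero_le _
  · exact le_rfl

end OnlineBMatching

open OnlineBMatching in
theorem mainTheorem3 (k d : ℕ) (hd : 2 ≤ d) (hkd : d ≤ k)
    (B : Finset ℕ) (hB : B.Nonempty) (hpos : ∀ b ∈ B, 1 ≤ b)
    (A : OnlineBMatching.OnlineAlgorithm) (c : ℝ)
    (hc : A.IsCompetitiveOn c
      {I : OnlineBMatching.Instance | I.IsKDGraph k d ∧ I.capacities = B}) :
    c ≤ OnlineBMatching.cStar k d (B.min' hB) := by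
  set b := B.min' hB with hbdef
  have hbB : b ∈ B := B.min'_mem hB
  have hb : 1 ≤ b := hpos b hbB
  have hb' : (0 : ℝ) < b := by exact_mod_cast hb
  have hd0 : 0 < d := by omega
  have hE := expectedLoad_eq_mul_cStar (k := k) hd (by omega) hb
  have hE0 := expectedLoad_nonneg b d (k * b) 0
  by_contra! hlt
  -- Needed to multiply the lower bound on the optimum by `c`.
  have hc0 : 0 ≤ c := by
    rw [hE] at hE0
    exact (nonneg_of_mul_nonneg_right hE0 hb').trans hlt.le
  have hgap : 0 < c * b - expectedLoad b d (k * b) 0 := by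
    rw [hE, mul_comm]
    exact sub_pos.mpr (mul_lt_mul_of_pos_left hlt hb')
  set C : ℕ := b * (k * b * (b + 1) * d) + ∑ i, B.orderEmbOfFin rfl i with hC
  -- Competitiveness will give `c * b * |S| ≤ |S| * expectedLoad b d (k * b) 0 + C` with `N ≤ |S|`,
  -- which fails for this `N`.
  obtain ⟨N, hN⟩ := exists_nat_gt ((C : ℝ) / (c * b - expectedLoad b d (k * b) 0))
  rw [div_lt_iff₀ hgap] at hN
  set cap := capacityProfile B b N with hcap
  obtain ⟨L, hL, hval⟩ := A.exists_isKDGraph_value_le cap (k := k) b hd0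
  have hcomp := hc ⟨_, cap, L⟩ ⟨hL, image_capacityProfile hbB N⟩
  set S := Finset.univ.filter fun s => cap s = b with hS
  have hNS : (N : ℝ) ≤ S.card := by exact_mod_cast le_card_capacityProfile_eq B b N
  have hopt : (S.card : ℝ) * b ≤ (Instance.opt ⟨_, cap, L⟩ : ℝ) := by
    have h1 : S.card * b ≤ ∑ s, cap s := by
      rw [← smul_eq_mul]
      refine (Finset.card_nsmul_le_sum S cap b fun s hs => (Finset.mem_filter.mp hs).2.ge).trans ?_
      exact Finset.sum_le_sum_of_subset (Finset.subset_univ S)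
    exact_mod_cast h1.trans (hL.sum_cap_le_opt hd0 hkd)
  have hrest : ((b * (k * b * (b + 1) * d) +
      ∑ s ∈ Finset.univ.filter (fun s => ¬ cap s = b), cap s : ℕ) : ℝ) ≤ C := by
    exact_mod_cast Nat.add_le_add_left (sum_capacityProfile_ne_le B b N) _
  have h1 := mul_le_mul_of_nonneg_left hopt hc0
  have h2 := mul_le_mul_of_nonneg_right hNS hgap.le
  linarith
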